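/- Let $G$ be a countable (finite or infinite, discrete) group. Call $G$ \emph{sofic} if there are integers $d_i\ge 1$ and maps $\sigma_i\colon G\to\mathrm{Sym}(d_i)$, $g\mapsto\sigma_{i,g}$ ($i\in\mathbb N$), such that $$\lim_{i\to\infty}\tfrac1{d_i}\bigl|\{a:\sigma_{i,s}\sigma_{i,t}(a)=\sigma_{i,st}(a)\}\bigr|=1\ \ (s,t\in G),\qquad \lim_{i\to\infty}\tfrac1{d_i}\bigl|\{a:\sigma_{i,s}(a)\ne\sigma_{i,t}(a)\}\bigr|=1\ \ (s\neq t\in G).$$ Such a sequence $\Sigma=(\sigma_i)$ with in addition $d_i\to\infty$ is called a \emph{sofic approximation} of $G$. Let $G$ act by homeomorphisms on a compact metric space $(X,\rho)$ and let $\Sigma$ be a sofic approximation of $G$. For a finite nonempty $F\subset G$, $\delta>0$ and $\sigma\colon G\to\mathrm{Sym}(d)$ put $$X^d_{F,\delta,\sigma}=\Bigl\{(x_1,\dots,x_d)\in X^d:\ \max_{s\in F}\Bigl(\tfrac1d\sum_{a=1}^d\rho(sx_a,x_{\sigma_s(a)})^2\Bigr)^{1/2}<\delta\Bigr\}.$$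 For a finite cover $\mathcal U$ of $X$ let $\mathcal U^d=\{U_1\times\dots\times U_d: U_a\in\mathcal U\}$, and let $N(\mathcal V,K)$ be the minimal cardinality of a subfamily of $\mathcal V$ covering $K$ (so $N(\mathcal V,\emptyset)=0$). With $\log 0=-\infty$, for finite open covers $\mathcal U_1,\mathcal U_2$ put $$h(G,\mathcal U_1|\mathcal U_2)=\inf_{F}\inf_{\delta>0}\limsup_{i\to\infty}\frac1{d_i}\log\max_{V\in\mathcal U_2^{d_i}}N\bigl(\mathcal U_1^{d_i},X^{d_i}_{F,\delta,\sigma_i}\cap V\bigr),\qquad h(G,X|\mathcal U_2)=\sup_{\mathcal U_1}h(G,\mathcal U_1|\mathcal U_2),$$ where $F$ ranges over the nonempty finite subsets of $G$ and $\mathcal U_1$ over the finite open covers of $X$. The action is \emph{$h$-expansive} (with respect to $\Sigma$) if $h(G,X|\mathcal U)\le 0$ for some finite open cover $\mathcal U$ of $X$. It is \emph{expansive} if there is $\delta>0$ such that for all distinct $x,y\in X$ there is $g\in G$ with $\rho(gx,gy)>\delta$. Let $G=G_0\ge G_1\ge G_2\ge\cdots$ be a chain of subgroups of finite index in $G$.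 The tree $T(G,(G_n))$ has as vertices of level $n$ the left cosets $gG_n$, with an edge from $g_1G_n$ to $g_2G_{n+1}$ whenever $g_2G_{n+1}\subset g_1G_n$. Its boundary $\partial T(G,(G_n))$ is the set of sequences $(x_0,x_1,\dots)$ with $x_n\in G/G_n$ and $x_n$ adjacent to $x_{n+1}$ for all $n\ge0$, with the (compact metrizable) topology generated by the sets $O_x=\{(x_n)_n: x_N=x\}$, $x\in G/G_N$, $N\ge0$. The left translations of $G$ on the sets $G/G_n$ induce an action of $G$ on $\partial T(G,(G_n))$ by homeomorphisms, the \emph{profinite action}. \textbf{Proposition.} Let $G$ be a countable sofic group, $(G_n)$ a chain of finite-index subgroups of $G$ as above, and $\rho$ any metric on $\partial T(G,(G_n))$ inducing its topology. Then the profinite action of $G$ on $\partial T(G,(G_n))$ is $h$-expansive with respect to every sofic approximation $\Sigma$ of $G$. Furthermore, if $\partial T(G,(G_n))$ is infinite, then the profinite action is not expansive. -/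

import Mathlib

open Filter Topology

namespace SoficHExpansive

/-! ### Sofic groups and sofic approximations -/

/-- The maps `σ i : G → Sym (d i)`, `i ∈ ℕ`, with `d i ≥ 1`, are asymptotically multiplicative
and asymptotically free. -/
structure IsSoficSequence {G : Type*} [Group G] (d : ℕ → ℕ)
    (σ : (i : ℕ) → G → Equiv.Perm (Fin (d i))) : Prop where
  pos : ∀ i, 0 < d i
  mul : ∀ s t : G, Tendsto
    (fun i => ((Finset.univ.filter fun a => σ i s (σ i t a) = σ i (s * t) a).card : ℝ) / (d i : ℝ))
    atTop (𝓝 1)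
  free : ∀ s t : G, s ≠ t → Tendsto
    (fun i => ((Finset.univ.filter fun a => σ i s a ≠ σ i t a).card : ℝ) / (d i : ℝ))
    atTop (𝓝 1)

/-- A group is sofic if it admits an asymptotically multiplicative and asymptotically free
sequence of maps into finite symmetric groups. -/
def IsSofic (G : Type*) [Group G] : Prop :=
  ∃ (d : ℕ → ℕ) (σ : (i : ℕ) → G → Equiv.Perm (Fin (d i))), IsSoficSequence d σ

/-- A sofic approximation of `G`: a sequence as above with `d i → ∞`. -/
structure SoficApproximation (G : Type*) [Group G] where
  d : ℕ → ℕ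
  σ : (i : ℕ) → G → Equiv.Perm (Fin (d i))
  isSoficSequence : IsSoficSequence d σ
  tendsto_d : Tendsto d atTop atTop

/-! ### Covers and conditional sofic entropy -/

/-- `U` is a finite open cover of `X`. -/
structure IsFiniteOpenCover {X : Type*} [TopologicalSpace X] (U : Set (Set X)) : Prop where
  finite : U.Finite
  isOpen : ∀ u ∈ U, IsOpen u
  sUnion_eq : ⋃₀ U = Set.univ

/-- `N(V, K)`: the minimal cardinality of a subfamily of `V` that covers `K`. -/
noncomputable def coverNumber {Y : Type*} (V : Set (Set Y)) (K : Set Y) : ℕ∞ :=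
  ⨅ (W : Set (Set Y)) (_ : W ⊆ V) (_ : K ⊆ ⋃₀ W), W.encard

/-- `U^d`: the family of all products `U_1 × ⋯ × U_d` with every `U_i` in `U`. -/
def coverPow {X : Type*} (U : Set (Set X)) (d : ℕ) : Set (Set (Fin d → X)) :=
  {P | ∃ u : Fin d → Set X, (∀ i, u i ∈ U) ∧ P = Set.univ.pi u}

section Entropy

variable {G : Type*} [Group G] {X : Type*} [MetricSpace X] [MulAction G X]

/-- `X^d_{F, δ, σ}`: the `d`-tuples that are `δ`-equivariant, in the mean-square sense, for all
elements of `F`. -/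
def approxOrbits (X : Type*) [MetricSpace X] [MulAction G X] (F : Finset G) (δ : ℝ) {d : ℕ}
    (σ : G → Equiv.Perm (Fin d)) : Set (Fin d → X) :=
  {x | ∀ s ∈ F, Real.sqrt (∑ i, (1 / (d : ℝ)) * dist (s • x i) (x (σ s i)) ^ 2) < δ}

/-- `h_{F, δ}(G, U₁ | U₂)`; here `ENNReal.log 0 = -∞`. -/
noncomputable def condEntropyAt (S : SoficApproximation G) (F : Finset G) (δ : ℝ)
    (U₁ U₂ : Set (Set X)) : EReal :=
  limsup (fun i : ℕ =>
    ENNReal.log ((⨆ V ∈ coverPow U₂ (S.d i),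
      coverNumber (coverPow U₁ (S.d i)) (approxOrbits X F δ (S.σ i) ∩ V) : ℕ∞) : ENNReal)
      / (S.d i : EReal)) atTop

/-- `h(G, U₁ | U₂)`: the infimum over nonempty finite `F ⊆ G` and `δ > 0`. -/
noncomputable def condEntropyCover (S : SoficApproximation G) (U₁ U₂ : Set (Set X)) : EReal :=
  ⨅ (F : Finset G) (_ : F.Nonempty) (δ : ℝ) (_ : 0 < δ), condEntropyAt S F δ U₁ U₂

/-- `h(G, X | U₂)`: the supremum over all finite open covers `U₁` of `X`. -/
noncomputable def condEntropy (S : SoficApproximation G) (U₂ : Set (Set X)) : EReal :=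
  ⨆ (U₁ : Set (Set X)) (_ : IsFiniteOpenCover U₁), condEntropyCover S U₁ U₂

/-- The action of `G` on `X` is `h`-expansive with respect to the sofic approximation `S`. -/
def IsHExpansive (S : SoficApproximation G) (X : Type*) [MetricSpace X] [MulAction G X] : Prop :=
  ∃ U : Set (Set X), IsFiniteOpenCover U ∧ condEntropy S U ≤ 0

/-- The action of `G` on `X` is expansive. -/
def IsExpansive (G : Type*) [Group G] (X : Type*) [MetricSpace X] [MulAction G X] : Prop :=
  ∃ δ : ℝ, 0 < δ ∧ ∀ x y : X, x ≠ y → ∃ g : G, δ < dist (g • x) (g • y)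

end Entropy

/-! ### Chains of finite-index subgroups, their coset trees and profinite actions -/

/-- A chain `G = G_0 ≥ G_1 ≥ ⋯` of finite-index subgroups of `G`. -/
structure SubgroupChain (G : Type*) [Group G] where
  subgroup : ℕ → Subgroup G
  zero_eq : subgroup 0 = ⊤
  antitone : Antitone subgroup
  finiteIndex : ∀ n, (subgroup n).FiniteIndex

namespace SubgroupChain

variable {G : Type*} [Group G] (C : SubgroupChain G)

/-- The vertices of the coset tree: the left cosets of the `G_n`, each with its level `n`. -/
abbrev Vertex : Type _ := Σ n : ℕ, G ⧸ C.subgroup n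

/-- A vertex `g G_n` as a subset of `G`. -/
def cosetSet (v : C.Vertex) : Set G := {g | (QuotientGroup.mk g : G ⧸ C.subgroup v.1) = v.2}

/-- The coset tree `T(G, (G_n))`: there is an edge from `g₁ G_n` to `g₂ G_m` if `m = n + 1` and
`g₂ G_m ⊆ g₁ G_n`. -/
def tree : Digraph C.Vertex where
  Adj v w := w.1 = v.1 + 1 ∧ C.cosetSet w ⊆ C.cosetSet v

/-- The boundary `∂T(G, (G_n))`: the sequences `(x_0, x_1, …)` with `x_n` a vertex of level `n`
and `x_n` adjacent to `x_{n+1}`. -/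
def Boundary : Type _ :=
  {x : (n : ℕ) → G ⧸ C.subgroup n // ∀ n, C.tree.Adj ⟨n, x n⟩ ⟨n + 1, x (n + 1)⟩}

/-- The basic set `O_x` of all boundary points through the vertex `x`. -/
def basicSet (v : C.Vertex) : Set C.Boundary := {b | b.1 v.1 = v.2}

/-- The topology of the boundary, generated by the sets `O_x`. -/
instance boundaryTopology : TopologicalSpace C.Boundary :=
  TopologicalSpace.generateFrom (Set.range C.basicSet)

theorem mem_cosetSet_smul (h : G) (n : ℕ) (q : G ⧸ C.subgroup n) (g : G) :
    g ∈ C.cosetSet ⟨n, h • q⟩ ↔ h⁻¹ * g ∈ C.cosetSet ⟨n, q⟩ := by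
  change (QuotientGroup.mk g : G ⧸ C.subgroup n) = h • q ↔
    h⁻¹ • (QuotientGroup.mk g : G ⧸ C.subgroup n) = q
  exact (inv_smul_eq_iff).symm

/-- The profinite action of `G` on the boundary, induced by left translation of cosets. -/
instance : MulAction G C.Boundary where
  smul h b := ⟨fun n => h • b.1 n, fun n => ⟨rfl, fun g hg => by
    rw [mem_cosetSet_smul] at hg ⊢
    exact (b.2 n).2 hg⟩⟩
  one_smul b := Subtype.ext (funext fun n => one_smul G (b.1 n))
  mul_smul g h b := Subtype.ext (funext fun n => mul_smul g h (b.1 n))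

theorem isOpen_basicSet (v : C.Vertex) : IsOpen (C.basicSet v) :=
  TopologicalSpace.isOpen_generateFrom_of_mem ⟨v, rfl⟩

instance : ContinuousConstSMul G C.Boundary where
  continuous_const_smul h := by
    refine continuous_generateFrom_iff.2 ?_
    rintro _ ⟨v, rfl⟩
    have : (fun b : C.Boundary => h • b) ⁻¹' C.basicSet v = C.basicSet ⟨v.1, h⁻¹ • v.2⟩ := by
      ext b
      change h • b.1 v.1 = v.2 ↔ b.1 v.1 = h⁻¹ • v.2
      exact smul_eq_iff_eq_inv_smul h
    rw [this]
    exact C.isOpen_basicSet _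

/-- The boundary embeds as a closed subspace of the product of the finite discrete spaces
`G / G_n`. -/
theorem isClosedEmbedding_val :
    letI : ∀ n, TopologicalSpace (G ⧸ C.subgroup n) := fun _ => ⊥
    IsClosedEmbedding (fun b : C.Boundary => b.1) := by
  let : ∀ n, TopologicalSpace (G ⧸ C.subgroup n) := fun _ => ⊥
  have : ∀ n, DiscreteTopology (G ⧸ C.subgroup n) := fun _ => ⟨rfl⟩
  refine ⟨⟨⟨le_antisymm ?_ ?_⟩, Subtype.val_injective⟩, ?_⟩
  · refine continuous_iff_le_induced.1 (continuous_pi fun n => ?_)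
    refine continuous_discrete_rng.2 fun q => C.isOpen_basicSet ⟨n, q⟩
  · refine le_generateFrom ?_
    rintro _ ⟨v, rfl⟩
    have h : IsOpen ((fun x : (n : ℕ) → G ⧸ C.subgroup n => x v.1) ⁻¹' {v.2}) :=
      (isOpen_discrete _).preimage (continuous_apply v.1)
    exact ⟨_, h, by ext b; rfl⟩
  · have : Set.range (fun b : C.Boundary => b.1) =
        ⋂ n, {x | C.tree.Adj ⟨n, x n⟩ ⟨n + 1, x (n + 1)⟩} := by
      ext x
      simp only [Set.mem_iInter, Set.mem_ofPred_eq]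
      exact ⟨fun ⟨b, hb⟩ => hb ▸ b.2, fun h => ⟨⟨x, h⟩, rfl⟩⟩
    rw [this]
    refine isClosed_iInter fun n => ?_
    have h := (isClosed_discrete {p : (G ⧸ C.subgroup n) × (G ⧸ C.subgroup (n + 1)) |
      C.tree.Adj ⟨n, p.1⟩ ⟨n + 1, p.2⟩}).preimage
      (((continuous_apply n).prodMk (continuous_apply (n + 1))) :
        Continuous fun x : (n : ℕ) → G ⧸ C.subgroup n => (x n, x (n + 1)))
    exact h

instance : CompactSpace C.Boundary := by
  let : ∀ n, TopologicalSpace (G ⧸ C.subgroup n) := fun _ => ⊥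
  have : ∀ n, Finite (G ⧸ C.subgroup n) := fun n =>
    have := C.finiteIndex n
    inferInstance
  exact C.isClosedEmbedding_val.compactSpace

instance : TopologicalSpace.MetrizableSpace C.Boundary := by
  let : ∀ n, TopologicalSpace (G ⧸ C.subgroup n) := fun _ => ⊥
  have : ∀ n, DiscreteTopology (G ⧸ C.subgroup n) := fun _ => ⟨rfl⟩
  exact C.isClosedEmbedding_val.isEmbedding.metrizableSpace

end SubgroupChain

end SoficHExpansive

/-! The level-`n` coset map `π` from the boundary to `Q = G/G_n` is an equivariant factor with
finite discrete image, and by compactness every open cover is refined by the fibres of one such map.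
Both claims follow from this.

Entropy, `G` infinite: even the trivial cover `{X}` works. An approximate orbit projects to a map `f
: [d] → Q` that is `F`-equivariant off a set `B` of at most `εd` indices, where `B` also contains
the indices at which `s ↦ σ_s a` is not injective on `F`. A maximal packing by disjoint patterns
`σ_F a` has at most `d/|F|` centres, and `f` is determined by its values on the centres and on `B`.
Since there are few small sets `B`, the number of such `f` has growth rate tending to `0` as `|F| →
∞` and `ε → 0` suitably (`exists_card_almost_equivariant_le`, `condEntropyCover_le_zero_of_factor`).

Entropy, `G` finite: `F` cannot grow, but the boundary is finite, and the cover by points leaves at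
most one tuple to cover.

Non-expansiveness: `G` permutes the finitely many level-`n` cylinders, so two points in one small
cylinder stay close under all of `G`. -/

namespace SoficHExpansive

/-! ### Counting almost equivariant maps -/

section Counting

variable {G : Type*} {α : Type*} [Fintype α]

/-- A maximal packing of `α` by the sets `σ F a`, with centres `a` outside `B`. -/
theorem exists_packing (σ : G → Equiv.Perm α) {F : Finset G} (hF : F.Nonempty) (B : Finset α)
    (hB : ∀ a ∉ B, Set.InjOn (fun s => σ s a) F) :
    ∃ A : Finset α, (∀ a ∈ A, a ∉ B) ∧ A.card * F.card ≤ Fintype.card α ∧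
      ∀ b ∉ B, ∃ a ∈ A, ∃ s ∈ F, ∃ t ∈ F, σ s b = σ t a := by
  classical
  let T : α → Finset α := fun a => F.image fun s => σ s a
  let P : Finset (Finset α) := Finset.univ.filter fun A =>
    (∀ a ∈ A, a ∉ B) ∧ (A : Set α).PairwiseDisjoint T
  obtain ⟨A, -, hA⟩ := P.exists_le_maximal (a := ∅) (by simp [P])
  obtain ⟨hAB, hdisj⟩ : (∀ a ∈ A, a ∉ B) ∧ (A : Set α).PairwiseDisjoint T := by
    simpa [P] using hA.prop
  refine ⟨A, hAB, ?_, fun b hb => ?_⟩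
  · calc A.card * F.card = ∑ a ∈ A, (T a).card := by
          rw [Finset.sum_congr rfl fun a ha => Finset.card_image_of_injOn (hB a (hAB a ha))]
          simp
      _ = (A.biUnion T).card := (Finset.card_biUnion hdisj).symm
      _ ≤ Fintype.card α := Finset.card_le_univ _
  · by_contra! hne
    have hbT : ∀ a ∈ A, Disjoint (T b) (T a) := fun a ha => by
      rw [Finset.disjoint_left]
      intro x hx hx'
      obtain ⟨s, hs, rfl⟩ := Finset.mem_image.1 hx
      obtain ⟨t, ht, h⟩ := Finset.mem_image.1 hx'
      exact hne a ha s hs t ht h.symm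
    have hins : insert b A ∈ P := by
      refine Finset.mem_filter.2 ⟨Finset.mem_univ _, ?_, ?_⟩
      · intro a ha
        rcases Finset.mem_insert.1 ha with rfl | ha
        exacts [hb, hAB a ha]
      · rw [Finset.coe_insert]
        exact hdisj.insert fun a ha _ => hbT a ha
    -- Maximality puts `b` in `A`; then `b` meets its own pattern, against `hne`.
    have hbA : b ∈ A := hA.le_of_ge hins (Finset.subset_insert b A) (Finset.mem_insert_self b A)
    obtain ⟨s, hs⟩ := hF
    exact hne b hbA s hs s hs rfl

/-- A set of size `d` has few subsets of size at most `ε d`. -/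
theorem card_small_subsets_le (ε L : ℝ) (hL : 0 ≤ L) :
    ((Finset.univ.filter fun B : Finset α => (B.card : ℝ) ≤ ε * Fintype.card α).card : ℝ) ≤
      Real.exp ((L * ε + Real.exp (-L)) * Fintype.card α) := by
  set d : ℝ := ((Fintype.card α : ℕ) : ℝ)
  set S := Finset.univ.filter fun B : Finset α => (B.card : ℝ) ≤ ε * d
  -- Chernoff bound: give each subset the weight `e^{-L|B|}`; the binomial theorem sums the weights
  -- to `(1 + e^{-L})^d`.
  have h1 : (S.card : ℝ) * Real.exp (-(L * (ε * d))) ≤ Real.exp (Real.exp (-L) * d) := by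
    calc (S.card : ℝ) * Real.exp (-(L * (ε * d)))
        = ∑ B ∈ S, Real.exp (-(L * (ε * d))) := by simp
      _ ≤ ∑ B ∈ S, Real.exp (-L) ^ B.card := by
          refine Finset.sum_le_sum fun B hB => ?_
          rw [← Real.exp_nat_mul]
          have := mul_le_mul_of_nonneg_left (Finset.mem_filter.1 hB).2 hL
          exact Real.exp_le_exp.2 (by linarith)
      _ ≤ ∑ B : Finset α, Real.exp (-L) ^ B.card :=
          Finset.sum_le_sum_of_subset_of_nonneg (Finset.subset_univ _) fun _ _ _ => by positivity
      _ = (Real.exp (-L) + 1) ^ Fintype.card α := by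
          have := Finset.sum_pow_mul_eq_add_pow (Real.exp (-L)) 1 (Finset.univ : Finset α)
          simpa using this
      _ ≤ Real.exp (Real.exp (-L)) ^ Fintype.card α := by
          gcongr
          exact Real.add_one_le_exp _
      _ = Real.exp (Real.exp (-L) * d) := by rw [← Real.exp_nat_mul, mul_comm]
  have h2 : (S.card : ℝ) = S.card * Real.exp (-(L * (ε * d))) * Real.exp (L * (ε * d)) := by
    rw [mul_assoc, ← Real.exp_add]; simp
  rw [h2]
  calc _ ≤ Real.exp (Real.exp (-L) * d) * Real.exp (L * (ε * d)) := by gcongr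
    _ = _ := by rw [← Real.exp_add]; ring_nf

variable [Group G] {Q : Type*} [Fintype Q] [MulAction G Q]

open Classical in
/-- Maps that are `F`-equivariant off `B` are determined by few values. -/
theorem card_equivariant_off_le (σ : G → Equiv.Perm α) {F : Finset G} (hF : F.Nonempty)
    (B : Finset α) (hB : ∀ a ∉ B, Set.InjOn (fun s => σ s a) F) (hQ : 0 < Fintype.card Q) :
    (Finset.univ.filter fun f : α → Q => ∀ a ∉ B, ∀ s ∈ F, f (σ s a) = s • f a).card ≤
      Fintype.card Q ^ (Fintype.card α / F.card + B.card) := by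
  obtain ⟨A, hAB, hcard, hA⟩ := exists_packing σ hF B hB
  let r : (α → Q) → ((A ∪ B : Finset α) → Q) := fun f a => f a
  have hr : Set.InjOn r (Finset.univ.filter fun f : α → Q =>
      ∀ a ∉ B, ∀ s ∈ F, f (σ s a) = s • f a) := by
    intro f hf g hg hfg
    simp only [Finset.coe_filter, Finset.mem_univ, true_and, Set.mem_ofPred_eq] at hf hg
    have heq : ∀ a ∈ A ∪ B, f a = g a := fun a ha => congrFun hfg ⟨a, ha⟩
    funext b
    by_cases hb : b ∈ B
    · exact heq b (Finset.mem_union_right _ hb)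
    · obtain ⟨a, ha, s, hs, t, ht, h⟩ := hA b hb
      -- With `σ_s b = σ_t a`, equivariance gives `s • f b = t • f a`, so `f a` determines `f b`.
      apply MulAction.injective s
      change s • f b = s • g b
      rw [← hf b hb s hs, ← hg b hb s hs, h, hf a (hAB a ha) t ht, hg a (hAB a ha) t ht,
        heq a (Finset.mem_union_left _ ha)]
  calc _ ≤ (Finset.univ : Finset ((A ∪ B : Finset α) → Q)).card :=
        Finset.card_le_card_of_injOn r (fun _ _ => Finset.mem_coe.2 (Finset.mem_univ _)) hr
    _ = Fintype.card Q ^ (A ∪ B).card := by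
        rw [Finset.card_univ, Fintype.card_fun, Fintype.card_coe]
    _ ≤ _ := by
        refine Nat.pow_le_pow_right hQ ((Finset.card_union_le A B).trans ?_)
        gcongr
        exact (Nat.le_div_iff_mul_le hF.card_pos).2 hcard

open Classical in
-- Union bound over `B`: the number of small sets times the count for a fixed one.
theorem card_almost_equivariant_le (σ : G → Equiv.Perm α) {F : Finset G} (hF : F.Nonempty)
    {ε L : ℝ} (hL : 0 ≤ L) (hQ : 0 < Fintype.card Q) :
    ((Finset.univ.filter fun f : α → Q => ∃ B : Finset α, (B.card : ℝ) ≤ ε * Fintype.card α ∧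
      (∀ a ∉ B, Set.InjOn (fun s => σ s a) F) ∧
      ∀ a ∉ B, ∀ s ∈ F, f (σ s a) = s • f a).card : ℝ) ≤
      Real.exp ((L * ε + Real.exp (-L) + Real.log (Fintype.card Q) * (1 / F.card + ε)) *
        Fintype.card α) := by
  set d : ℝ := ((Fintype.card α : ℕ) : ℝ)
  set m := Fintype.card Q
  have hm : (1 : ℝ) ≤ m := by exact_mod_cast hQ
  let S := Finset.univ.filter fun B : Finset α => (B.card : ℝ) ≤ ε * d
  let E : Finset α → Finset (α → Q) := fun B => Finset.univ.filter fun f =>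
    (∀ a ∉ B, Set.InjOn (fun s => σ s a) F) ∧ ∀ a ∉ B, ∀ s ∈ F, f (σ s a) = s • f a
  have hE : ∀ B ∈ S, ((E B).card : ℝ) ≤ Real.exp (Real.log m * (1 / F.card + ε) * d) := by
    intro B hB
    have hBε : (B.card : ℝ) ≤ ε * d := (Finset.mem_filter.1 hB).2
    by_cases hinj : ∀ a ∉ B, Set.InjOn (fun s => σ s a) F
    · have h1 : (E B).card ≤ m ^ (Fintype.card α / F.card + B.card) := by
        refine le_trans (Finset.card_le_card fun f hf => ?_)
          (card_equivariant_off_le (Q := Q) σ hF B hinj hQ)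
        exact Finset.mem_filter.2 ⟨Finset.mem_univ _, (Finset.mem_filter.1 hf).2.2⟩
      calc ((E B).card : ℝ) ≤ (m : ℝ) ^ (Fintype.card α / F.card + B.card) := by exact_mod_cast h1
        _ = Real.exp (((Fintype.card α / F.card + B.card : ℕ) : ℝ) * Real.log m) := by
            rw [Real.exp_nat_mul, Real.exp_log (by linarith)]
        _ ≤ _ := by
            refine Real.exp_le_exp.2 ?_
            have h2 : ((Fintype.card α / F.card + B.card : ℕ) : ℝ) ≤ (1 / F.card + ε) * d := by
              push_cast
              have : ((Fintype.card α / F.card : ℕ) : ℝ) ≤ d / F.card := Nat.cast_div_le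
              calc _ ≤ d / F.card + ε * d := add_le_add this hBε
                _ = _ := by ring
            calc _ ≤ (1 / F.card + ε) * d * Real.log m :=
                  mul_le_mul_of_nonneg_right h2 (Real.log_nonneg hm)
              _ = _ := by ring
    · have : E B = ∅ := Finset.filter_false_of_mem fun f _ h => hinj h.1
      rw [this]
      simpa using (Real.exp_pos _).le
  have hsub : (Finset.univ.filter fun f : α → Q => ∃ B : Finset α, (B.card : ℝ) ≤ ε * d ∧
      (∀ a ∉ B, Set.InjOn (fun s => σ s a) F) ∧
      ∀ a ∉ B, ∀ s ∈ F, f (σ s a) = s • f a) ⊆ S.biUnion E := by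
    intro f hf
    obtain ⟨B, hB, h⟩ := (Finset.mem_filter.1 hf).2
    exact Finset.mem_biUnion.2 ⟨B, Finset.mem_filter.2 ⟨Finset.mem_univ _, hB⟩,
      Finset.mem_filter.2 ⟨Finset.mem_univ _, h⟩⟩
  calc _ ≤ ((S.biUnion E).card : ℝ) := by exact_mod_cast Finset.card_le_card hsub
    _ ≤ ∑ B ∈ S, ((E B).card : ℝ) := by exact_mod_cast Finset.card_biUnion_le
    _ ≤ ∑ B ∈ S, Real.exp (Real.log m * (1 / F.card + ε) * d) := Finset.sum_le_sum hE
    _ = S.card * Real.exp (Real.log m * (1 / F.card + ε) * d) := by simp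
    _ ≤ Real.exp ((L * ε + Real.exp (-L)) * d) *
        Real.exp (Real.log m * (1 / F.card + ε) * d) := by
        gcongr
        exact card_small_subsets_le ε L hL
    _ = _ := by rw [← Real.exp_add]; ring_nf

/-- Almost equivariant maps into a finite set have exponential growth rate at most `η`. -/
theorem exists_card_almost_equivariant_le (Q : Type*) [Fintype Q] [Nonempty Q] {η : ℝ}
    (hη : 0 < η) : ∃ k : ℕ, 0 < k ∧ ∃ ε : ℝ, 0 < ε ∧
      ∀ {G : Type*} [Group G] [MulAction G Q] {α : Type*} [Fintype α] (σ : G → Equiv.Perm α)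
        (F : Finset G), F.card = k →
      ∃ E : Finset (α → Q), (E.card : ℝ) ≤ Real.exp (η * Fintype.card α) ∧
        ∀ (f : α → Q) (B : Finset α), (B.card : ℝ) ≤ ε * Fintype.card α →
          (∀ a ∉ B, Set.InjOn (fun s => σ s a) F) →
          (∀ a ∉ B, ∀ s ∈ F, f (σ s a) = s • f a) → f ∈ E := by
  classical
  have hQ : 0 < Fintype.card Q := Fintype.card_pos
  set l := Real.log (Fintype.card Q)
  have hl : 0 ≤ l := Real.log_natCast_nonneg _
  obtain ⟨L, hL, hLη⟩ : ∃ L : ℝ, 0 ≤ L ∧ Real.exp (-L) ≤ η / 3 := by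
    have h := (Real.tendsto_exp_neg_atTop_nhds_zero.eventually_le_const
      (show (0 : ℝ) < η / 3 by positivity)).and (eventually_ge_atTop 0)
    obtain ⟨L, h1, h2⟩ := h.exists
    exact ⟨L, h2, h1⟩
  obtain ⟨k, hk⟩ := exists_nat_gt (l / (η / 3))
  have hk0 : (0 : ℝ) < k := lt_of_le_of_lt (by positivity) hk
  -- The exponent splits into `e^{-L}`, `l/k` and `(L + l)ε`; `L`, then `k` and `ε`, make each at
  -- most `η/3`.
  refine ⟨k, by exact_mod_cast hk0, η / 3 / (L + l + 1), by positivity, ?_⟩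
  intro G _ _ α _ σ F hF
  have hFne : F.Nonempty := Finset.card_pos.1 (by rw [hF]; exact_mod_cast hk0)
  refine ⟨_, (card_almost_equivariant_le σ hFne hL hQ).trans (Real.exp_le_exp.2 ?_),
    fun f B h₁ h₂ h₃ => Finset.mem_filter.2 ⟨Finset.mem_univ _, B, h₁, h₂, h₃⟩⟩
  refine mul_le_mul_of_nonneg_right ?_ (Nat.cast_nonneg _)
  have h1 : l * (1 / k) ≤ η / 3 := by
    rw [div_lt_iff₀ (by positivity)] at hk
    rw [mul_one_div, div_le_iff₀ hk0]
    linarith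
  have h2 : (L + l) * (η / 3 / (L + l + 1)) ≤ η / 3 := by
    rw [mul_div_assoc', div_le_iff₀ (by positivity)]
    nlinarith
  rw [hF]
  change L * _ + _ + l * _ ≤ η
  linarith

end Counting

/-! ### Upper bounds for conditional entropy -/

theorem coverNumber_le {Y : Type*} {V W : Set (Set Y)} {K : Set Y} (hW : W ⊆ V)
    (hK : K ⊆ ⋃₀ W) : coverNumber V K ≤ W.encard :=
  iInf_le_of_le W (iInf_le_of_le hW (iInf_le _ hK))

theorem condEntropyCover_le {G : Type*} [Group G] {X : Type*} [MetricSpace X] [MulAction G X]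
    (S : SoficApproximation G) {U₁ U₂ : Set (Set X)} {F : Finset G} (hF : F.Nonempty) {δ : ℝ}
    (hδ : 0 < δ) (η : ℝ) (h : ∀ᶠ i in atTop, ∃ M : ℕ, (M : ℝ) ≤ Real.exp (η * S.d i) ∧
      ∀ V ∈ coverPow U₂ (S.d i),
        coverNumber (coverPow U₁ (S.d i)) (approxOrbits X F δ (S.σ i) ∩ V) ≤ M) :
    condEntropyCover S U₁ U₂ ≤ (η : EReal) := by
  refine iInf_le_of_le F (iInf_le_of_le hF (iInf_le_of_le δ (iInf_le_of_le hδ ?_)))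
  refine limsup_le_of_le (by isBoundedDefault) (h.mono ?_)
  rintro i ⟨M, hM, hV⟩
  have hd : (0 : EReal) < (S.d i : EReal) := by exact_mod_cast S.isSoficSequence.pos i
  rw [EReal.div_le_iff_le_mul hd (EReal.natCast_ne_top _)]
  have hle : ((⨆ V ∈ coverPow U₂ (S.d i),
      coverNumber (coverPow U₁ (S.d i)) (approxOrbits X F δ (S.σ i) ∩ V) : ℕ∞) : ENNReal) ≤
      ENNReal.ofReal (Real.exp (η * S.d i)) := by
    calc _ ≤ ((M : ℕ∞) : ENNReal) := ENat.toENNReal_le.2 (iSup₂_le hV)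
      _ = ENNReal.ofReal (M : ℝ) := by simp
      _ ≤ _ := ENNReal.ofReal_le_ofReal hM
  refine (ENNReal.log_monotone hle).trans ?_
  rw [ENNReal.log_ofReal, if_neg (Real.exp_pos _).not_ge, Real.log_exp]
  push_cast
  rw [mul_comm]

/-- The action on a finite space has no entropy relative to the cover by points. -/
theorem isHExpansive_of_finite {G : Type*} [Group G] {X : Type*} [MetricSpace X] [Finite X]
    [MulAction G X] (S : SoficApproximation G) : IsHExpansive S X := by
  refine ⟨Set.range fun x : X => {x}, ⟨Set.finite_range _, ?_, ?_⟩, iSup₂_le fun U₁ hU₁ => ?_⟩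
  · rintro _ ⟨x, rfl⟩
    exact isOpen_discrete _
  · exact Set.eq_univ_of_forall fun x => ⟨{x}, ⟨x, rfl⟩, rfl⟩
  refine condEntropyCover_le S (Finset.singleton_nonempty 1) one_pos 0
    (Eventually.of_forall fun i => ⟨1, by simp, ?_⟩)
  rintro _ ⟨v, hv, rfl⟩
  choose x hx using hv
  have hcov : ∀ y : X, ∃ u ∈ U₁, y ∈ u := fun y =>
    Set.mem_sUnion.1 (hU₁.sUnion_eq ▸ Set.mem_univ y)
  choose u hu hxu using fun a => hcov (x a)
  -- A product of singletons is a single tuple, so one product set covers it.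
  refine (coverNumber_le (W := {Set.univ.pi u}) ?_ ?_).trans (by simp)
  · rintro _ rfl
    exact ⟨u, hu, rfl⟩
  · rintro y ⟨-, hy⟩
    refine ⟨_, rfl, fun a _ => ?_⟩
    have : y a ∈ v a := hy a (Set.mem_univ a)
    rw [← hx a, Set.mem_singleton_iff] at this
    rw [this]
    exact hxu a

open Classical in
theorem IsSoficSequence.eventually_card_not_injOn_le {G : Type*} [Group G] {d : ℕ → ℕ}
    {σ : (i : ℕ) → G → Equiv.Perm (Fin (d i))} (h : IsSoficSequence d σ) (F : Finset G)
    {ε : ℝ} (hε : 0 < ε) : ∀ᶠ i in atTop,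
      ((Finset.univ.filter fun a => ¬ Set.InjOn (fun s => σ i s a) F).card : ℝ) ≤ ε * d i := by
  -- An equal share of `ε` for each ordered pair in `F`; the `+ 1` keeps the denominator positive
  -- when there are no pairs.
  set c : ℝ := ε / (F.offDiag.card + 1)
  have hc : 0 < c := by positivity
  have hpair : ∀ p ∈ F.offDiag, ∀ᶠ i in atTop,
      ((Finset.univ.filter fun a => σ i p.1 a = σ i p.2 a).card : ℝ) ≤ c * d i := by
    intro p hp
    have hlim := h.free p.1 p.2 (Finset.mem_offDiag.1 hp).2.2
    filter_upwards [hlim.eventually_const_lt (show 1 - c < 1 by linarith)] with i hi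
    have hd : (0 : ℝ) < d i := by exact_mod_cast h.pos i
    have hsum := Finset.card_filter_add_card_filter_not (s := (Finset.univ : Finset (Fin (d i))))
      (fun a => σ i p.1 a = σ i p.2 a)
    rw [Finset.card_univ, Fintype.card_fin] at hsum
    have hsum' : ((Finset.univ.filter fun a => σ i p.1 a = σ i p.2 a).card : ℝ) +
        (Finset.univ.filter fun a => σ i p.1 a ≠ σ i p.2 a).card = d i := by
      exact_mod_cast hsum
    rw [lt_div_iff₀ hd] at hi
    linarith
  filter_upwards [(Filter.eventually_all_finset F.offDiag).2 hpair] with i hi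
  have hsub : (Finset.univ.filter fun a => ¬ Set.InjOn (fun s => σ i s a) F) ⊆
      F.offDiag.biUnion fun p => Finset.univ.filter fun a => σ i p.1 a = σ i p.2 a := by
    intro a ha
    have := (Finset.mem_filter.1 ha).2
    simp only [Set.InjOn, not_forall] at this
    obtain ⟨s, hs, t, ht, hst, hne⟩ := this
    exact Finset.mem_biUnion.2 ⟨(s, t), Finset.mem_offDiag.2 ⟨hs, ht, hne⟩,
      Finset.mem_filter.2 ⟨Finset.mem_univ _, hst⟩⟩
  calc _ ≤ ((F.offDiag.biUnion fun p =>
        Finset.univ.filter fun a => σ i p.1 a = σ i p.2 a).card : ℝ) := by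
        exact_mod_cast Finset.card_le_card hsub
    _ ≤ ∑ p ∈ F.offDiag, ((Finset.univ.filter fun a => σ i p.1 a = σ i p.2 a).card : ℝ) := by
        exact_mod_cast Finset.card_biUnion_le
    _ ≤ ∑ p ∈ F.offDiag, c * d i := Finset.sum_le_sum hi
    _ = (F.offDiag.card * c) * d i := by rw [Finset.sum_const, nsmul_eq_mul, mul_assoc]
    _ ≤ ε * d i := by
        refine mul_le_mul_of_nonneg_right ?_ (Nat.cast_nonneg _)
        rw [mul_div_assoc', div_le_iff₀ (by positivity)]
        nlinarith

/-! ### Finite discrete factors -/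

section Factor

variable {G : Type*} [Group G] {X : Type*} [MetricSpace X] [MulAction G X]
  {Q : Type*} [MulAction G Q] {π : X → Q} {κ : ℝ}

open Classical in
/-- Almost orbits have almost equivariant images in a discrete factor. -/
theorem card_not_equivariant_le (hπ : ∀ (g : G) x, π (g • x) = g • π x) (hκ : 0 < κ)
    (hπκ : ∀ x y, dist x y < κ → π x = π y) {F : Finset G} {δ : ℝ} (hδ : 0 < δ) {d : ℕ}
    (hd : 0 < d) {σ : G → Equiv.Perm (Fin d)} {x : Fin d → X} (hx : x ∈ approxOrbits X F δ σ)
    {s : G} (hs : s ∈ F) :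
    ((Finset.univ.filter fun a => π (x (σ s a)) ≠ s • π (x a)).card : ℝ) ≤
      (δ / κ) ^ 2 * d := by
  have hd' : (0 : ℝ) < d := by exact_mod_cast hd
  have h := (Real.sqrt_lt' hδ).1 (hx s hs)
  set B := Finset.univ.filter fun a => π (x (σ s a)) ≠ s • π (x a)
  -- Chebyshev: each bad index contributes at least `κ² / d` to the mean square.
  have h1 : B.card * (1 / d * κ ^ 2) ≤ δ ^ 2 := by
    calc B.card * (1 / d * κ ^ 2) = ∑ a ∈ B, 1 / (d : ℝ) * κ ^ 2 := by simp
      _ ≤ ∑ a ∈ B, 1 / (d : ℝ) * dist (s • x a) (x (σ s a)) ^ 2 := by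
          refine Finset.sum_le_sum fun a ha => ?_
          have : κ ≤ dist (s • x a) (x (σ s a)) := by
            by_contra! hlt
            exact (Finset.mem_filter.1 ha).2 (by rw [← hπ, hπκ _ _ hlt])
          gcongr
      _ ≤ ∑ a, 1 / (d : ℝ) * dist (s • x a) (x (σ s a)) ^ 2 :=
          Finset.sum_le_sum_of_subset_of_nonneg (Finset.subset_univ _) fun _ _ _ => by positivity
      _ ≤ δ ^ 2 := h.le
  rw [div_pow, div_mul_eq_mul_div, le_div_iff₀ (by positivity)]
  calc B.card * κ ^ 2 = B.card * (1 / d * κ ^ 2) * d := by field_simp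
    _ ≤ δ ^ 2 * d := by gcongr

/-- Cover an arbitrary set by the products indexed by its images in a discrete factor. -/
theorem coverNumber_coverPow_le_card {X Q : Type*} {π : X → Q} {U₁ : Set (Set X)}
    (hU₁ : ∀ q, ∃ u ∈ U₁, π ⁻¹' {q} ⊆ u) {d : ℕ} {K : Set (Fin d → X)}
    (E : Finset (Fin d → Q)) (hE : ∀ x ∈ K, (fun a => π (x a)) ∈ E) :
    coverNumber (coverPow U₁ d) K ≤ E.card := by
  choose u hu hπu using hU₁
  refine (coverNumber_le (W := (fun f : Fin d → Q => Set.univ.pi fun a => u (f a)) '' E)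
    ?_ ?_).trans ((Set.encard_image_le _ _).trans (Set.encard_coe_eq_coe_finsetCard E).le)
  · rintro _ ⟨f, -, rfl⟩
    exact ⟨fun a => u (f a), fun a => hu _, rfl⟩
  · intro x hx
    exact ⟨_, ⟨_, hE x hx, rfl⟩, fun a _ => hπu _ rfl⟩

open Classical in
theorem exists_exceptional_set (hπ : ∀ (g : G) x, π (g • x) = g • π x) (hκ : 0 < κ)
    (hπκ : ∀ x y, dist x y < κ → π x = π y) {F : Finset G} {ε δ : ℝ} (hδ : 0 < δ)
    (hδκ : F.card * (δ / κ) ^ 2 ≤ ε / 2) {d : ℕ} (hd : 0 < d) {σ : G → Equiv.Perm (Fin d)}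
    (hσ : ((Finset.univ.filter fun a => ¬ Set.InjOn (fun s => σ s a) F).card : ℝ) ≤ ε / 2 * d)
    {x : Fin d → X} (hx : x ∈ approxOrbits X F δ σ) :
    ∃ B : Finset (Fin d), (B.card : ℝ) ≤ ε * d ∧
      (∀ a ∉ B, Set.InjOn (fun s => σ s a) F) ∧
      ∀ a ∉ B, ∀ s ∈ F, π (x (σ s a)) = s • π (x a) := by
  let B₁ := F.biUnion fun s => Finset.univ.filter fun a => π (x (σ s a)) ≠ s • π (x a)
  let B₂ := Finset.univ.filter fun a => ¬ Set.InjOn (fun s => σ s a) F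
  refine ⟨B₁ ∪ B₂, ?_, ?_, ?_⟩
  · have hB₁ : (B₁.card : ℝ) ≤ ε / 2 * d := by
      calc (B₁.card : ℝ) ≤ ∑ s ∈ F,
            ((Finset.univ.filter fun a => π (x (σ s a)) ≠ s • π (x a)).card : ℝ) := by
            exact_mod_cast Finset.card_biUnion_le
        _ ≤ ∑ s ∈ F, (δ / κ) ^ 2 * d :=
            Finset.sum_le_sum fun s hs => card_not_equivariant_le hπ hκ hπκ hδ hd hx hs
        _ = F.card * (δ / κ) ^ 2 * d := by rw [Finset.sum_const, nsmul_eq_mul, mul_assoc]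
        _ ≤ ε / 2 * d := by gcongr
    have h : ((B₁ ∪ B₂).card : ℝ) ≤ B₁.card + B₂.card := by
      exact_mod_cast Finset.card_union_le B₁ B₂
    have hB₂ : (B₂.card : ℝ) ≤ ε / 2 * d := hσ
    linarith
  · intro a ha
    by_contra hinj
    exact ha (Finset.mem_union_right _ (Finset.mem_filter.2 ⟨Finset.mem_univ _, hinj⟩))
  · intro a ha s hs
    by_contra hne
    exact ha (Finset.mem_union_left _ (Finset.mem_biUnion.2
      ⟨s, hs, Finset.mem_filter.2 ⟨Finset.mem_univ _, hne⟩⟩))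

/-- An infinite group has no entropy relative to a cover refined by a finite discrete factor. -/
theorem condEntropyCover_le_zero_of_factor [Infinite G] [Finite Q] [Nonempty Q]
    (hπ : ∀ (g : G) x, π (g • x) = g • π x) (hκ : 0 < κ)
    (hπκ : ∀ x y, dist x y < κ → π x = π y) (S : SoficApproximation G) {U₁ : Set (Set X)}
    (U₂ : Set (Set X)) (hU₁ : ∀ q, ∃ u ∈ U₁, π ⁻¹' {q} ⊆ u) :
    condEntropyCover S U₁ U₂ ≤ 0 := by
  have := Fintype.ofFinite Q
  rw [← EReal.le_of_forall_lt_iff_le]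
  intro η hη
  obtain ⟨k, hk, ε, hε, hcount⟩ := exists_card_almost_equivariant_le Q
    (show 0 < η by exact_mod_cast hη)
  obtain ⟨F, hF⟩ := Infinite.exists_subset_card_eq G k
  have hFne : F.Nonempty := Finset.card_pos.1 (hF ▸ hk)
  have hk' : (0 : ℝ) < k := by exact_mod_cast hk
  obtain ⟨δ, hδ, hδκ⟩ : ∃ δ : ℝ, 0 < δ ∧ F.card * (δ / κ) ^ 2 ≤ ε / 2 := by
    -- Solves `k (δ/κ)² = ε/2`.
    refine ⟨κ * Real.sqrt (ε / 2 / k), by positivity, le_of_eq ?_⟩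
    rw [mul_div_cancel_left₀ _ hκ.ne', Real.sq_sqrt (by positivity), hF,
      mul_div_cancel₀ _ hk'.ne']
  refine condEntropyCover_le S hFne hδ η ?_
  filter_upwards [S.isSoficSequence.eventually_card_not_injOn_le F (half_pos hε)] with i hi
  obtain ⟨E, hEcard, hE⟩ := hcount (S.σ i) F hF
  rw [Fintype.card_fin] at hEcard hE
  refine ⟨E.card, hEcard, fun V _ => coverNumber_coverPow_le_card hU₁ E fun x hx => ?_⟩
  obtain ⟨B, h₁, h₂, h₃⟩ := exists_exceptional_set hπ hκ hπκ hδ hδκ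
    (S.isSoficSequence.pos i) hi hx.1
  exact hE _ B h₁ h₂ h₃

end Factor

/-! ### Cylinders of the coset tree -/

namespace SubgroupChain

variable {G : Type*} [Group G] (C : SubgroupChain G)

/-- The boundary point of cosets of `g`. -/
def ofElement (g : G) : C.Boundary :=
  ⟨fun _ => QuotientGroup.mk g, fun n => ⟨rfl, fun _ hh => QuotientGroup.eq.2
    (C.antitone n.le_succ (QuotientGroup.eq.1 hh))⟩⟩

theorem cosetSet_antitone (x : C.Boundary) :
    Antitone fun n => C.cosetSet ⟨n, x.1 n⟩ :=
  antitone_nat_of_succ_le fun n => (x.2 n).2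

theorem mem_basicSet_self (x : C.Boundary) (n : ℕ) : x ∈ C.basicSet ⟨n, x.1 n⟩ :=
  rfl

/-- Cosets along a ray are nested, so an element of the common level-`n` coset lies in both
level-`m` cosets. -/
theorem val_eq_of_le {x y : C.Boundary} {m n : ℕ} (hmn : m ≤ n) (h : x.1 n = y.1 n) :
    x.1 m = y.1 m := by
  obtain ⟨g, hg⟩ := QuotientGroup.mk_surjective (x.1 n)
  have hx : g ∈ C.cosetSet ⟨m, x.1 m⟩ := C.cosetSet_antitone x hmn hg
  have hy : g ∈ C.cosetSet ⟨m, y.1 m⟩ := C.cosetSet_antitone y hmn (hg.trans h)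
  exact hx.symm.trans hy

theorem basicSet_subset {x : C.Boundary} {m n : ℕ} (hmn : m ≤ n) :
    C.basicSet ⟨n, x.1 n⟩ ⊆ C.basicSet ⟨m, x.1 m⟩ :=
  fun _ hy => C.val_eq_of_le hmn hy

theorem exists_basicSet_subset {u : Set C.Boundary} (hu : IsOpen u) {x : C.Boundary}
    (hx : x ∈ u) : ∃ n, C.basicSet ⟨n, x.1 n⟩ ⊆ u := by
  induction hu with
  | basic s hs =>
    obtain ⟨⟨n, q⟩, rfl⟩ := hs
    obtain rfl : x.1 n = q := hx
    exact ⟨n, subset_rfl⟩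
  | univ => exact ⟨0, Set.subset_univ _⟩
  | inter s t _ _ hs ht =>
    obtain ⟨m, hm⟩ := hs hx.1
    obtain ⟨n, hn⟩ := ht hx.2
    exact ⟨max m n, Set.subset_inter ((C.basicSet_subset (le_max_left m n)).trans hm)
      ((C.basicSet_subset (le_max_right m n)).trans hn)⟩
  | sUnion T _ hT =>
    obtain ⟨t, ht, hxt⟩ := hx
    obtain ⟨n, hn⟩ := hT t ht hxt
    exact ⟨n, hn.trans (Set.subset_sUnion_of_mem ht)⟩

/-- Every open cover of the boundary is refined by the cylinders of some level. -/
theorem exists_level {U : Set (Set C.Boundary)} (hU : ∀ u ∈ U, IsOpen u)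
    (hcov : ⋃₀ U = Set.univ) : ∃ n, ∀ q, ∃ u ∈ U, C.basicSet ⟨n, q⟩ ⊆ u := by
  have h : ∀ x : C.Boundary, ∃ n, ∃ u ∈ U, C.basicSet ⟨n, x.1 n⟩ ⊆ u := by
    intro x
    obtain ⟨u, hu, hx⟩ := Set.mem_sUnion.1 (hcov ▸ Set.mem_univ x)
    obtain ⟨n, hn⟩ := C.exists_basicSet_subset (hU u hu) hx
    exact ⟨n, u, hu, hn⟩
  choose n u hu hn using h
  obtain ⟨t, ht⟩ := CompactSpace.elim_nhds_subcover (fun x => C.basicSet ⟨n x, x.1 (n x)⟩)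
    fun x => (C.isOpen_basicSet _).mem_nhds (C.mem_basicSet_self x _)
  refine ⟨t.sup n, fun q => ?_⟩
  obtain ⟨g, rfl⟩ := QuotientGroup.mk_surjective q
  -- One point of the cylinder suffices: the covering cylinder containing it has level at most
  -- `t.sup n`, hence contains the whole cylinder.
  have hg : C.ofElement g ∈ ⋃ x ∈ t, C.basicSet ⟨n x, x.1 (n x)⟩ := ht ▸ Set.mem_univ _
  obtain ⟨x, hxt, hx⟩ := Set.mem_iUnion₂.1 hg
  refine ⟨u x, hu x, fun y hy => hn x ?_⟩
  have : y.1 (n x) = (C.ofElement g).1 (n x) := C.val_eq_of_le (Finset.le_sup hxt) hy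
  exact this.trans hx

/-- The cosets along a ray decrease in a finite set, so they stabilise; any element of the stable
coset represents the whole ray. -/
theorem finite_boundary [Finite G] : Finite C.Boundary := by
  refine Finite.of_surjective C.ofElement fun x => ?_
  obtain ⟨n, hn⟩ := WellFoundedGT.monotone_chain_condition
    (α := (Set G)ᵒᵈ) ⟨fun n => OrderDual.toDual (C.cosetSet ⟨n, x.1 n⟩),
      (C.cosetSet_antitone x).dual_right⟩
  obtain ⟨g, hg⟩ := QuotientGroup.mk_surjective (x.1 n)
  refine ⟨g, Subtype.ext (funext fun m => ?_)⟩
  rcases le_total m n with hmn | hnm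
  · exact C.cosetSet_antitone x hmn hg
  · have : C.cosetSet ⟨n, x.1 n⟩ = C.cosetSet ⟨m, x.1 m⟩ := hn m hnm
    exact this.subset hg

end SubgroupChain

end SoficHExpansive

theorem proposition1310022211 {G : Type*} [Group G] [Countable G]
    (hG : SoficHExpansive.IsSofic G) (C : SoficHExpansive.SubgroupChain G)
    (ρ : MetricSpace C.Boundary)
    (hρ : ρ.toUniformSpace.toTopologicalSpace = C.boundaryTopology) :
    (∀ S : SoficHExpansive.SoficApproximation G, SoficHExpansive.IsHExpansive S C.Boundary) ∧
      (Infinite C.Boundary → ¬ SoficHExpansive.IsExpansive G C.Boundary) := by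
  have hopen : ∀ u : Set C.Boundary,
      IsOpen[ρ.toUniformSpace.toTopologicalSpace] u ↔ IsOpen[C.boundaryTopology] u :=
    fun u => by rw [hρ]
  have hfin : ∀ n, Finite (G ⧸ C.subgroup n) := fun n => by
    have := C.finiteIndex n
    infer_instance
  refine ⟨fun S => ?_, fun hinf => ?_⟩
  · rcases finite_or_infinite G with hfinG | hinfG
    · have := C.finite_boundary
      exact SoficHExpansive.isHExpansive_of_finite S
    refine ⟨{Set.univ}, @SoficHExpansive.IsFiniteOpenCover.mk _
      ρ.toUniformSpace.toTopologicalSpace _ (Set.finite_singleton _) ?_ (Set.sUnion_singleton _),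
      iSup₂_le fun U₁ hU₁ => ?_⟩
    · rintro _ rfl
      exact (hopen _).2 isOpen_univ
    obtain ⟨-, hUopen, hUcov⟩ := hU₁
    obtain ⟨n, hn⟩ := C.exists_level (fun u hu => (hopen u).1 (hUopen u hu)) hUcov
    have hcompact : @IsCompact C.Boundary ρ.toUniformSpace.toTopologicalSpace Set.univ := by
      rw [hρ]
      exact isCompact_univ
    -- A Lebesgue number of the level-`n` cylinders: points closer than `κ` have the same level-`n`
    -- coset.
    obtain ⟨κ, hκ, hball⟩ := lebesgue_number_lemma_of_metric
      (c := fun q => C.basicSet ⟨n, q⟩) hcompact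
      (fun q => (hopen _).2 (C.isOpen_basicSet _))
      (fun x _ => Set.mem_iUnion.2 ⟨x.1 n, C.mem_basicSet_self x n⟩)
    refine SoficHExpansive.condEntropyCover_le_zero_of_factor (π := fun x : C.Boundary => x.1 n)
      (fun _ _ => rfl) hκ (fun x y hxy => ?_) S _ hn
    obtain ⟨q, hq⟩ := hball x (Set.mem_univ x)
    have hx : x.1 n = q := hq (Metric.mem_ball_self hκ)
    have hy : y.1 n = q := hq (Metric.mem_ball'.2 hxy)
    exact hx.trans hy.symm
  · rintro ⟨δ, hδ, h⟩
    obtain ⟨n, hn⟩ := C.exists_level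
      (U := Set.range fun x : C.Boundary => Metric.ball x (δ / 2))
      (by rintro _ ⟨x, rfl⟩; exact (hopen _).1 Metric.isOpen_ball)
      (Set.eq_univ_of_forall fun x => ⟨_, ⟨x, rfl⟩, Metric.mem_ball_self (half_pos hδ)⟩)
    -- Pigeonhole: infinitely many points, finitely many level-`n` cosets.
    obtain ⟨x, y, hne, hxy⟩ := Finite.exists_ne_map_eq_of_infinite fun x : C.Boundary => x.1 n
    obtain ⟨g, hg⟩ := h x y hne
    obtain ⟨_, ⟨z, rfl⟩, hz⟩ := hn (g • x.1 n)
    have hx : g • x ∈ Metric.ball z (δ / 2) := hz rfl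
    have hy : g • y ∈ Metric.ball z (δ / 2) := hz (congrArg (g • ·) hxy.symm)
    have := dist_triangle_right (g • x) (g • y) z
    rw [Metric.mem_ball] at hx hy
    linarith
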